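/- Let $p$ be a prime, $s\ge 1$, and let $m,n,d$ be integers with $2\le d\le m\le n$. For a matrix $A\in\mathbb{Z}_{p^s}^{m\times n}$ (that is, over $\mathbb{Z}/p^s\mathbb{Z}$), let the inner rank $\rho(A)$ be the least integer $r\ge 0$ such that $A=BC$ for some $B\in\mathbb{Z}_{p^s}^{m\times r}$ and $C\in\mathbb{Z}_{p^s}^{r\times n}$ (so $\rho(A)=0$ if and only if $A=0$). Let $\Gamma=\Gamma_d(\mathbb{Z}_{p^s}^{m\times n})$ be the generalized bilinear forms graph: its vertex set is $\mathbb{Z}_{p^s}^{m\times n}$, and two distinct vertices $A,B$ are adjacent if and only if $\rho(A-B)<d$. Let $\overline{\Gamma}$ be the complement of $\Gamma$, and let $\chi,\alpha,\omega$ denote the chromatic number, the independence number and the clique number. Then $$\chi(\overline{\Gamma})=\alpha(\Gamma)=\omega(\overline{\Gamma}).$$ Call a graph a core if each of its endomorphisms is an automorphism, and call a subgraph $H$ of a graph $G$ a core of $G$ if $H$ is a core and there is a homomorphism from $G$ to $H$. Then $\overline{\Gamma}$ has a core, every core of $\overline{\Gamma}$ is a maximum clique of $\overline{\Gamma}$ (a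 complete subgraph with the largest possible number of vertices), and $\overline{\Gamma}$ is not a core. -/

import Mathlib

/-- The inner rank of an `m × n` matrix `A`: the least `r` such that `A = B * C` with `B` of size
`m × r` and `C` of size `r × n`. The value `r = 0` is attained exactly by `A = 0`, so for `A ≠ 0`
this is the least positive such integer. -/
noncomputable def innerRank {R : Type*} [CommRing R] {m n : ℕ}
    (A : Matrix (Fin m) (Fin n) R) : ℕ :=
  sInf {r : ℕ | ∃ (B : Matrix (Fin m) (Fin r) R) (C : Matrix (Fin r) (Fin n) R), A = B * C}

theorem innerRank_neg {R : Type*} [CommRing R] {m n : ℕ} (A : Matrix (Fin m) (Fin n) R) :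
    innerRank (-A) = innerRank A := by
  unfold innerRank
  congr 1
  ext r
  constructor
  · rintro ⟨B, C, h⟩
    exact ⟨-B, C, by rw [Matrix.neg_mul, ← h, neg_neg]⟩
  · rintro ⟨B, C, h⟩
    exact ⟨-B, C, by rw [Matrix.neg_mul, ← h]⟩

/-- The generalized bilinear forms graph `Γ_d(R^{m × n})`: the vertices are the `m × n` matrices
over `R`, and two distinct matrices are adjacent when their difference has inner rank `< d`. -/
def bilinearFormsGraph (R : Type*) [CommRing R] (m n d : ℕ) :
    SimpleGraph (Matrix (Fin m) (Fin n) R) where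
  Adj A B := A ≠ B ∧ innerRank (A - B) < d
  symm := ⟨fun A B h => ⟨h.1.symm, by rw [← neg_sub, innerRank_neg]; exact h.2⟩⟩
  loopless := ⟨fun _ h => h.1 rfl⟩

/-- A graph is a core if each of its endomorphisms is an automorphism. -/
def IsCore {V : Type*} (G : SimpleGraph V) : Prop :=
  ∀ f : G →g G, ∃ e : G ≃g G, ∀ v : V, e v = f v

/-- A subgraph `H` of `G` is a core of `G` if `H` is a core and there is a homomorphism
from `G` to `H`. -/
def IsCoreOf {V : Type*} {G : SimpleGraph V} (H : G.Subgraph) : Prop :=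
  IsCore H.coe ∧ Nonempty (G →g H.coe)

/-- A subgraph `H` of `G` is a maximum clique of `G` if it is complete and its vertex set is a
clique of `G` of maximum cardinality. -/
def IsMaximumCliqueSubgraph {V : Type*} [Finite V] {G : SimpleGraph V} (H : G.Subgraph) : Prop :=
  H.coe = ⊤ ∧ ∃ S : Finset V, (S : Set V) = H.verts ∧ G.IsMaximumClique S

/-! Let `k = m + 1 - d` and let `α` be the set of `k × n` matrices over `ℤ/p^s`. Keeping the first
`k` rows colors `Γᶜ` by `α`: two matrices that agree there differ in at most `d - 1` rows, so their
difference has inner rank below `d`. Conversely `α` embeds as a clique of `Γᶜ` by an additive code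
of minimum inner rank at least `d`. The code comes from lifting Gabidulin codes over `𝔽_p`
(`exists_innerRank_code`). A coloring and a clique of the same size give χ = ω = |α|, and
homomorphisms both ways between `Γᶜ` and a complete graph force every core to be a maximum clique.
-/

/-! ### Graphs homomorphically equivalent to a complete graph -/

/-- An endomorphism of a core is injective. -/
theorem IsCore.injective {V : Type*} {G : SimpleGraph V} (h : IsCore G) (f : G →g G) :
    Function.Injective f := by
  obtain ⟨e, he⟩ := h f
  intro a b hab
  exact e.injective (by rw [he, he, hab])

theorem injective_of_top_hom {V α : Type*} {G : SimpleGraph V} (ι : (⊤ : SimpleGraph α) →g G) :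
    Function.Injective ι := by
  intro a b hab
  by_contra hne
  exact (ι.map_adj (show (⊤ : SimpleGraph α).Adj a b from hne)).ne hab

/-- A finite complete graph is a core. -/
theorem isCore_top {V : Type*} [Finite V] : IsCore (⊤ : SimpleGraph V) := by
  intro f
  have hinj : Function.Injective f := injective_of_top_hom f
  refine ⟨⟨Equiv.ofBijective f (Finite.injective_iff_bijective.mp hinj), ?_⟩, fun v => rfl⟩
  intro a b
  simp [hinj.eq_iff]

theorem isClique_range_of_top_hom {V α : Type*} {G : SimpleGraph V}
    (ι : (⊤ : SimpleGraph α) →g G) : G.IsClique (Set.range ι) := by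
  rintro _ ⟨a, rfl⟩ _ ⟨b, rfl⟩ hab
  exact ι.map_adj (show (⊤ : SimpleGraph α).Adj a b from fun h => hab (by rw [h]))

theorem chromaticNumber_eq_card_of_coloring_of_top_hom {V α : Type*} {G : SimpleGraph V}
    [Fintype α] (c : G.Coloring α) (ι : (⊤ : SimpleGraph α) →g G) :
    G.chromaticNumber = Fintype.card α := by
  classical
  refine le_antisymm c.colorable.chromaticNumber_le ?_
  have h := SimpleGraph.IsClique.card_le_chromaticNumber (s := Finset.univ.image ι)
    (by simpa using isClique_range_of_top_hom ι)
  rwa [Finset.card_image_of_injective _ (injective_of_top_hom ι)] at h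

theorem cliqueNum_eq_card_of_coloring_of_top_hom {V α : Type*} {G : SimpleGraph V} [Finite V]
    [Fintype α] (c : G.Coloring α) (ι : (⊤ : SimpleGraph α) →g G) :
    G.cliqueNum = Fintype.card α := by
  classical
  refine le_antisymm ?_ ?_
  · obtain ⟨t, ht⟩ := G.exists_isNClique_cliqueNum
    rw [← ht.card_eq]
    exact ht.isClique.card_le_of_coloring c
  · have h := SimpleGraph.IsClique.card_le_cliqueNum (G := G) (t := Finset.univ.image ι)
      (tc := by simpa using isClique_range_of_top_hom ι)
    rwa [Finset.card_image_of_injective _ (injective_of_top_hom ι)] at h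

theorem exists_isCoreOf_of_coloring_of_top_hom {V α : Type*} {G : SimpleGraph V}
    [Finite α] (c : G.Coloring α) (ι : (⊤ : SimpleGraph α) →g G) :
    ∃ H : G.Subgraph, IsCoreOf H := by
  let H : G.Subgraph := (⊤ : G.Subgraph).induce (Set.range ι)
  have hadj : ∀ a b : α, a ≠ b → H.Adj (ι a) (ι b) := fun a b hab =>
    ⟨⟨a, rfl⟩, ⟨b, rfl⟩, ι.map_adj (show (⊤ : SimpleGraph α).Adj a b from hab)⟩
  have htop : H.coe = ⊤ := by
    ext ⟨x, a, rfl⟩ ⟨y, b, rfl⟩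
    simp only [SimpleGraph.Subgraph.coe_adj, SimpleGraph.top_adj, ne_eq]
    exact ⟨fun h he => h.ne (congrArg Subtype.val he), fun h => hadj a b fun hab => h (Subtype.ext (congrArg ι hab))⟩
  have : Finite H.verts := (Set.finite_range ι).to_subtype
  refine ⟨H, by rw [htop]; exact isCore_top, ⟨fun v => ⟨ι (c v), ⟨c v, rfl⟩⟩, ?_⟩⟩
  intro a b hab
  exact hadj _ _ (c.valid hab)

/-- The composite `H → K_α → H` is an endomorphism of a core, hence injective. So `H` and `α` have
equal size, and the clique map `K_α → H` is onto, which makes `H` complete. -/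
theorem IsCoreOf.isMaximumCliqueSubgraph {V α : Type*} {G : SimpleGraph V} [Finite V]
    (c : G.Coloring α) (ι : (⊤ : SimpleGraph α) →g G) {H : G.Subgraph} (h : IsCoreOf H) :
    IsMaximumCliqueSubgraph H := by
  classical
  obtain ⟨hcore, ⟨r⟩⟩ := h
  let f : H.coe →g (⊤ : SimpleGraph α) := c.comp H.hom
  let g : (⊤ : SimpleGraph α) →g H.coe := r.comp ι
  have hginj : Function.Injective g := injective_of_top_hom g
  have : Finite α := Finite.of_injective g hginj
  have hfinj : Function.Injective f := fun a b hab =>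
    hcore.injective (g.comp f) (congrArg g hab)
  have hgsurj : Function.Surjective g := by
    have := Fintype.ofFinite α
    have := Fintype.ofFinite H.verts
    exact ((Fintype.bijective_iff_injective_and_card g).mpr ⟨hginj,
      le_antisymm (Fintype.card_le_of_injective g hginj)
        (Fintype.card_le_of_injective f hfinj)⟩).2
  have htop : H.coe = ⊤ := by
    ext x y
    refine ⟨fun hxy => hxy.ne, fun hxy => ?_⟩
    obtain ⟨a, rfl⟩ := hgsurj x
    obtain ⟨b, rfl⟩ := hgsurj y
    exact g.map_adj (show (⊤ : SimpleGraph α).Adj a b from fun hab => hxy.ne (by rw [hab]))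
  refine ⟨htop, H.verts.toFinite.toFinset, by simp, ?_, ?_⟩
  · intro x hx y hy hxy
    have hx' : x ∈ H.verts := by simpa using hx
    have hy' : y ∈ H.verts := by simpa using hy
    have : H.coe.Adj ⟨x, hx'⟩ ⟨y, hy'⟩ := by
      rw [htop]
      exact fun he => hxy (congrArg Subtype.val he)
    exact H.adj_sub this
  · intro t ht
    have := Fintype.ofFinite α
    refine (ht.card_le_of_coloring c).trans ?_
    rw [← Set.ncard_eq_toFinset_card, ← Nat.card_eq_fintype_card, ← Nat.card_coe_set_eq]
    exact Nat.card_le_card_of_injective g hginj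

theorem not_isCore_of_coloring_of_top_hom {V α : Type*} {G : SimpleGraph V}
    (c : G.Coloring α) (ι : (⊤ : SimpleGraph α) →g G) (hc : ¬ Function.Injective c) :
    ¬ IsCore G := fun h =>
  hc fun _ _ hab => h.injective (ι.comp c) (congrArg ι hab)

/-! ### Inner rank and reduction modulo `p` -/

open Module in
/-- Reducing a matrix over a principal ideal domain to a quotient field does not raise the rank. -/
theorem Matrix.rank_map_le_rank {R K : Type*} [CommRing R] [IsDomain R] [IsPrincipalIdealRing R]
    [Field K] (φ : R →+* K) {m n : ℕ} (N : Matrix (Fin m) (Fin n) R) :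
    (N.map φ).rank ≤ N.rank := by
  -- Over a PID the column space is free, so `N` factors through `R ^ N.rank`, and `φ` preserves the
  -- factorization.
  let b : Basis (Fin N.rank) R (LinearMap.range N.mulVecLin) := Module.finBasis R _
  let B : Matrix (Fin m) (Fin N.rank) R := fun i j => (b j : Fin m → R) i
  let C : Matrix (Fin N.rank) (Fin n) R := fun j l =>
    b.repr ⟨N.mulVecLin (Pi.single l 1), LinearMap.mem_range_self _ _⟩ j
  have hN : N = B * C := by
    ext i l
    have h := congrArg (fun v : LinearMap.range N.mulVecLin => (v : Fin m → R) i)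
      (b.sum_repr ⟨N.mulVecLin (Pi.single l 1), LinearMap.mem_range_self _ _⟩)
    simp only [Submodule.coe_sum, Submodule.coe_smul, Finset.sum_apply, Pi.smul_apply,
      smul_eq_mul, Matrix.mulVecLin_apply, Matrix.mulVec_single_one, Matrix.col_apply] at h
    rw [← h, Matrix.mul_apply]
    exact Finset.sum_congr rfl fun j _ => by simp only [B, C, Matrix.mulVecLin_apply,
      Matrix.mulVec_single_one, mul_comm]
  calc (N.map φ).rank = (B.map φ * C.map φ).rank := by
        conv_lhs => rw [hN, Matrix.map_mul]
    _ ≤ (B.map φ).rank := Matrix.rank_mul_le_left _ _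
    _ ≤ N.rank := Matrix.rank_le_width _

theorem innerRank_le_of_eq_mul {R : Type*} [CommRing R] {m n r : ℕ}
    {A : Matrix (Fin m) (Fin n) R} (B : Matrix (Fin m) (Fin r) R) (C : Matrix (Fin r) (Fin n) R)
    (h : A = B * C) : innerRank A ≤ r :=
  Nat.sInf_le ⟨B, C, h⟩

theorem exists_eq_mul_innerRank {R : Type*} [CommRing R] {m n : ℕ}
    (A : Matrix (Fin m) (Fin n) R) :
    ∃ (B : Matrix (Fin m) (Fin (innerRank A)) R) (C : Matrix (Fin (innerRank A)) (Fin n) R),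
      A = B * C :=
  Nat.sInf_mem (s := {r : ℕ | ∃ (B : Matrix (Fin m) (Fin r) R) (C : Matrix (Fin r) (Fin n) R),
    A = B * C}) ⟨n, A, 1, (Matrix.mul_one A).symm⟩

/-- A matrix supported on `r` rows has inner rank at most `r`. -/
theorem innerRank_le_of_rows_eq_zero {R : Type*} [CommRing R] {m n k r : ℕ}
    (A : Matrix (Fin m) (Fin n) R) (hm : m ≤ k + r)
    (hA : ∀ i : Fin m, (i : ℕ) < k → ∀ l, A i l = 0) : innerRank A ≤ r := by
  refine innerRank_le_of_eq_mul (Matrix.of fun i j => if (i : ℕ) = k + j then 1 else 0)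
    (Matrix.of fun j l => if h : k + (j : ℕ) < m then A ⟨k + j, h⟩ l else 0) ?_
  ext i l
  rw [Matrix.mul_apply]
  by_cases hi : (i : ℕ) < k
  · rw [hA i hi, Finset.sum_eq_zero]
    intro j _
    rw [Matrix.of_apply, if_neg (by omega), zero_mul]
  · have hir : (i : ℕ) - k < r := by omega
    rw [Finset.sum_eq_single (⟨i - k, hir⟩ : Fin r)]
    · have : k + ((i : ℕ) - k) = i := by omega
      simp [this]
    · intro j _ hj
      rw [Matrix.of_apply, if_neg, zero_mul]
      intro h
      exact hj (Fin.ext (by simp; omega))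
    · simp

/-- The inner rank over `ℤ/p^s` of a nonzero multiple `p^e N` is at least the rank of `N`
modulo `p`. -/
theorem rank_le_innerRank_pow_smul {p s e m n : ℕ} [Fact p.Prime] (he : e < s)
    (N : Matrix (Fin m) (Fin n) ℤ) :
    (N.map (Int.castRingHom (ZMod p))).rank ≤
      innerRank (((p : ℤ) ^ e • N).map (Int.castRingHom (ZMod (p ^ s)))) := by
  obtain ⟨B, C, h⟩ := exists_eq_mul_innerRank
    (((p : ℤ) ^ e • N).map (Int.castRingHom (ZMod (p ^ s))))
  have hsurj : Function.Surjective (Int.castRingHom (ZMod (p ^ s))) := ZMod.intCast_surjective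
  generalize innerRank (((p : ℤ) ^ e • N).map (Int.castRingHom (ZMod (p ^ s)))) = r at B C h ⊢
  obtain ⟨B', rfl⟩ : ∃ B' : Matrix (Fin m) (Fin r) ℤ,
      B'.map (Int.castRingHom (ZMod (p ^ s))) = B :=
    ⟨B.map (Function.surjInv hsurj), by ext; simp only [Matrix.map_apply, Function.surjInv_eq]⟩
  obtain ⟨C', rfl⟩ : ∃ C' : Matrix (Fin r) (Fin n) ℤ,
      C'.map (Int.castRingHom (ZMod (p ^ s))) = C :=
    ⟨C.map (Function.surjInv hsurj), by ext; simp only [Matrix.map_apply, Function.surjInv_eq]⟩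
  rw [← Matrix.map_mul] at h
  have hdvd : ∀ i j, (p : ℤ) ^ s ∣ (p : ℤ) ^ e * N i j - (B' * C') i j := by
    intro i j
    have hij := congrFun (congrFun h i) j
    simp only [Matrix.map_apply, Matrix.smul_apply, smul_eq_mul, eq_intCast] at hij
    have := (ZMod.intCast_eq_intCast_iff_dvd_sub _ _ _).mp hij.symm
    exact_mod_cast this
  choose X hX using hdvd
  -- Absorbing the error `p^s X` into `N` makes the factorization exact over `ℤ`; since `e < s`, `M`
  -- is still congruent to `N` modulo `p`.
  let M : Matrix (Fin m) (Fin n) ℤ := N - (p : ℤ) ^ (s - e) • Matrix.of X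
  have hM : (p : ℤ) ^ e • M = B' * C' := by
    ext i j
    have hp : (p : ℤ) ^ e * (p : ℤ) ^ (s - e) = (p : ℤ) ^ s := by
      rw [← pow_add]; congr 1; omega
    simp only [Matrix.smul_apply, Matrix.sub_apply, Matrix.of_apply, smul_eq_mul, M]
    rw [mul_sub, ← mul_assoc, hp, ← hX]
    ring
  have hMN : M.map (Int.castRingHom (ZMod p)) = N.map (Int.castRingHom (ZMod p)) := by
    ext i j
    have : s - e ≠ 0 := by omega
    simp [M, this]
  have hp0 : (p : ℤ) ^ e ∈ nonZeroDivisors ℤ :=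
    mem_nonZeroDivisors_of_ne_zero
      (pow_ne_zero _ (by exact_mod_cast (Fact.out : p.Prime).ne_zero))
  calc (N.map (Int.castRingHom (ZMod p))).rank = (M.map (Int.castRingHom (ZMod p))).rank := by
        rw [hMN]
    _ ≤ M.rank := Matrix.rank_map_le_rank _ _
    _ = (B' * C').rank := by rw [← hM, Matrix.rank_smul_of_mem_nonZeroDivisors _ hp0]
    _ ≤ B'.rank := Matrix.rank_mul_le_left _ _
    _ ≤ r := Matrix.rank_le_width _

/-! ### Gabidulin codes over a finite field -/

open Module Polynomial FiniteField in
/-- The kernel of a nonzero `q`-linearized polynomial of `q`-degree less than `k` has dimension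
less than `k`. -/
theorem finrank_ker_linearized_lt {K L : Type*} [Field K] [Fintype K] [Field L] [Algebra K L]
    [FiniteDimensional K L] {k : ℕ} (c : Fin k → L) (hc : c ≠ 0) (f : L →ₗ[K] L)
    (hf : ∀ x, f x = ∑ j, c j * x ^ Fintype.card K ^ (j : ℕ)) :
    finrank K (LinearMap.ker f) < k := by
  classical
  have hq : 1 < Fintype.card K := Fintype.one_lt_card
  let P : L[X] := ∑ j, C (c j) * X ^ Fintype.card K ^ (j : ℕ)
  obtain ⟨j₀, hj₀⟩ := Function.ne_iff.mp hc
  have hP : P ≠ 0 := by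
    intro h
    apply hj₀
    have := congrArg (fun Q : L[X] => Q.coeff (Fintype.card K ^ (j₀ : ℕ))) h
    simp only [P, finsetSum_coeff, coeff_C_mul, coeff_X_pow, coeff_zero] at this
    rw [Finset.sum_eq_single j₀] at this
    · simpa using this
    · intro j _ hj
      rw [if_neg, mul_zero]
      intro he
      exact hj (Fin.ext (Nat.pow_right_injective hq he).symm)
    · simp
  have hdeg : P.natDegree ≤ Fintype.card K ^ (k - 1) := by
    refine natDegree_sum_le_of_forall_le _ _ fun j _ => ?_
    refine (natDegree_C_mul_X_pow_le _ _).trans ?_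
    exact Nat.pow_le_pow_right hq.le (by omega)
  have hsub : (LinearMap.ker f : Set L) ⊆ P.roots.toFinset := by
    intro x hx
    have hx' : f x = 0 := hx
    simp only [Finset.mem_coe, Multiset.mem_toFinset, mem_roots', IsRoot.def]
    refine ⟨hP, ?_⟩
    simpa [P, eval_finsetSum, hf] using hx'
  have hcard : Fintype.card K ^ finrank K (LinearMap.ker f) ≤ Fintype.card K ^ (k - 1) := by
    calc Fintype.card K ^ finrank K (LinearMap.ker f) = Nat.card (LinearMap.ker f) := by
          rw [Module.natCard_eq_pow_finrank (K := K), Nat.card_eq_fintype_card]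
      _ = (LinearMap.ker f : Set L).ncard := rfl
      _ ≤ (P.roots.toFinset : Set L).ncard := Set.ncard_le_ncard hsub (Finset.finite_toSet _)
      _ = P.roots.toFinset.card := Set.ncard_coe_finset _
      _ ≤ Multiset.card P.roots := Multiset.toFinset_card_le _
      _ ≤ _ := (card_roots' P).trans hdeg
  have := (Nat.pow_le_pow_iff_right hq).mp hcard
  have := j₀.pos
  omega

open Module in
/-- Gabidulin codes: a linear code of `m × n` matrices of dimension `k n` in which every nonzero
word has rank at least `m - k + 1`. -/
theorem exists_gabidulin_generators (K L : Type*) [Field K] [Fintype K] [Field L] [Algebra K L]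
    [FiniteDimensional K L] {m n k : ℕ} (hL : finrank K L = n) (hmn : m ≤ n) :
    ∃ G : Fin k → Fin n → Matrix (Fin m) (Fin n) K, ∀ x : Fin k → Fin n → K, x ≠ 0 →
      m < k + (∑ j, ∑ l, x j l • G j l).rank := by
  let b : Basis (Fin n) K L := Module.finBasisOfFinrankEq K L hL
  let a : Fin m → L := fun i => b (Fin.castLE hmn i)
  have ha : LinearIndependent K a :=
    b.linearIndependent.comp _ (Fin.castLE_injective hmn)
  refine ⟨fun j l => Matrix.of fun i => b.equivFun (b l * a i ^ Fintype.card K ^ (j : ℕ)), ?_⟩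
  intro x hx
  -- The codeword of `x` lists the values at the `a i` of the linearized polynomial with
  -- coefficients `c j`.
  let c : Fin k → L := fun j => ∑ l, x j l • b l
  have hc : c ≠ 0 := by
    intro h
    apply hx
    funext j l
    have hj : ∑ l, x j l • b l = 0 := congrFun h j
    exact Fintype.linearIndependent_iff.mp b.linearIndependent _ hj l
  let f : L →ₗ[K] L := ∑ j : Fin k, (LinearMap.mulLeft K (c j)).comp
    ((FiniteField.frobeniusAlgHom K L) ^ (j : ℕ)).toLinearMap
  have hf : ∀ y, f y = ∑ j, c j * y ^ Fintype.card K ^ (j : ℕ) := by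
    intro y
    simp [f, AlgHom.coe_pow, FiniteField.coe_frobeniusAlgHom, pow_iterate]
  have hker := finrank_ker_linearized_lt c hc f hf
  set M := ∑ j, ∑ l, x j l • Matrix.of
    fun i => b.equivFun (b l * a i ^ Fintype.card K ^ (j : ℕ)) with hM
  have hrow : ∀ i, M i = b.equivFun (f (a i)) := by
    intro i
    funext t
    rw [hf, hM]
    simp only [c, Finset.sum_mul, map_sum, smul_mul_assoc, map_smul, Finset.sum_apply,
      Matrix.sum_apply, Matrix.smul_apply, Matrix.of_apply, Pi.smul_apply]
  have hmul : ∀ v : Fin m → K,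
      M.transpose.mulVecLin v = b.equivFun (f (Fintype.linearCombination K a v)) := by
    intro v
    funext t
    simp only [Matrix.mulVecLin_apply, Fintype.linearCombination_apply, map_sum, map_smul,
      Finset.sum_apply, Pi.smul_apply, smul_eq_mul, ← hrow, Matrix.mulVec, dotProduct,
      Matrix.transpose_apply, mul_comm]
  have hinj : Function.Injective (Fintype.linearCombination K a) :=
    linearIndependent_iff_injective_fintypeLinearCombination.mp ha
  -- Independence of the `a i` embeds the left kernel of `M` in `ker f`, of dimension below `k`.
  have hle : finrank K (LinearMap.ker M.transpose.mulVecLin) ≤ finrank K (LinearMap.ker f) := by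
    refine LinearMap.finrank_le_finrank_of_injective
      (f := (Fintype.linearCombination K a).restrict
        (p := LinearMap.ker M.transpose.mulVecLin) (q := LinearMap.ker f) ?_) ?_
    · intro v hv
      rw [LinearMap.mem_ker, hmul] at hv
      exact b.equivFun.map_eq_zero_iff.mp hv
    · intro v w hvw
      exact Subtype.ext (hinj (congrArg Subtype.val hvw))
  have hrn := LinearMap.finrank_range_add_finrank_ker M.transpose.mulVecLin
  rw [Module.finrank_fin_fun] at hrn
  have hrank : finrank K (LinearMap.range M.transpose.mulVecLin) = M.rank := Matrix.rank_transpose M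
  omega

/-! ### Lifting the code to `ℤ/p^s`, and the main theorem -/

/-- A family of integers not all divisible by `q ^ s` is `q ^ e` times a family not all divisible
by `q`, for some `e < s`. -/
theorem exists_eq_pow_mul_of_not_pow_dvd {ι : Type*} (q : ℤ) (s : ℕ) (y : ι → ℤ)
    (hy : ¬ ∀ i, q ^ s ∣ y i) :
    ∃ e < s, ∃ z : ι → ℤ, (∀ i, y i = q ^ e * z i) ∧ ¬ ∀ i, q ∣ z i := by
  induction s generalizing y with
  | zero => simp at hy
  | succ s ih =>
    by_cases h : ∀ i, q ∣ y i
    · choose w hw using h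
      obtain ⟨e, he, z, hz, hq⟩ := ih w fun h' => hy fun i => by
        rw [hw, pow_succ']
        exact mul_dvd_mul_left _ (h' i)
      exact ⟨e + 1, by omega, z, fun i => by rw [hw, hz, pow_succ', mul_assoc], hq⟩
    · exact ⟨0, by omega, y, fun i => by simp, h⟩

/-- There is a free code of `m × n` matrices over `ℤ/p^s` of rank `k n` in which every nonzero word
has inner rank at least `m - k + 1`. -/
theorem exists_innerRank_code (p s : ℕ) [Fact p.Prime] {m n k : ℕ} (hmn : m ≤ n) (hn : n ≠ 0) :
    ∃ Ψ : (Fin k → Fin n → ZMod (p ^ s)) →+ Matrix (Fin m) (Fin n) (ZMod (p ^ s)),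
      ∀ x, x ≠ 0 → m < k + innerRank (Ψ x) := by
  obtain ⟨G, hG⟩ := exists_gabidulin_generators (ZMod p) (GaloisField p n) (k := k)
    (GaloisField.finrank p hn) hmn
  have hsurj : Function.Surjective (Int.castRingHom (ZMod p)) := ZMod.intCast_surjective
  let T : Fin k → Fin n → Matrix (Fin m) (Fin n) ℤ :=
    -- Any entrywise lift works: after a power of `p` is factored out of a nonzero word, only its
    -- residue modulo `p` matters.
    fun j l => (G j l).map (Function.surjInv hsurj)
  have hT : ∀ j l i t, (T j l i t : ZMod p) = G j l i t := fun j l i t =>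
    Function.surjInv_eq hsurj (G j l i t)
  let Ψ : (Fin k → Fin n → ZMod (p ^ s)) →+ Matrix (Fin m) (Fin n) (ZMod (p ^ s)) :=
    { toFun := fun x => ∑ j, ∑ l, x j l • (T j l).map (Int.castRingHom (ZMod (p ^ s)))
      map_zero' := by simp
      map_add' := fun x y => by simp [add_smul, Finset.sum_add_distrib] }
  refine ⟨Ψ, fun x hx => ?_⟩
  choose y hy using fun j l => ZMod.intCast_surjective (x j l)
  obtain ⟨e, he, z, hz, hpz⟩ := exists_eq_pow_mul_of_not_pow_dvd (p : ℤ) s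
    (fun i : Fin k × Fin n => y i.1 i.2) (by
      intro h
      apply hx
      funext j l
      rw [← hy, Pi.zero_apply, Pi.zero_apply, ZMod.intCast_zmod_eq_zero_iff_dvd]
      exact_mod_cast h (j, l))
  let N : Matrix (Fin m) (Fin n) ℤ := ∑ j, ∑ l, z (j, l) • T j l
  have hN : N.map (Int.castRingHom (ZMod p)) = ∑ j, ∑ l, (z (j, l) : ZMod p) • G j l := by
    ext i t
    simp [N, Matrix.sum_apply, hT]
  have hΨ : Ψ x = ((p : ℤ) ^ e • N).map (Int.castRingHom (ZMod (p ^ s))) := by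
    ext i t
    simp only [Ψ, N, AddMonoidHom.coe_mk, ZeroHom.coe_mk, Matrix.sum_apply, Matrix.smul_apply,
      Matrix.map_apply, smul_eq_mul, Finset.mul_sum, map_sum, map_mul, eq_intCast, ← hy]
    refine Finset.sum_congr rfl fun j _ => Finset.sum_congr rfl fun l _ => ?_
    have h := hz (j, l)
    dsimp only at h
    rw [h]
    push_cast
    ring
  have hx' : (fun j l => (z (j, l) : ZMod p)) ≠ 0 := by
    intro h
    refine hpz fun i => ?_
    rw [← ZMod.intCast_zmod_eq_zero_iff_dvd]
    exact congrFun (congrFun h i.1) i.2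
  have h1 := hG _ hx'
  have h2 := rank_le_innerRank_pow_smul (p := p) he N
  rw [hN] at h2
  rw [hΨ]
  omega

theorem theorem4p7 (p s m n d : ℕ) [Fact p.Prime] (hs : 1 ≤ s)
    (hd : 2 ≤ d) (hdm : d ≤ m) (hmn : m ≤ n)
    (Γ : SimpleGraph (Matrix (Fin m) (Fin n) (ZMod (p ^ s))))
    (hΓ : Γ = bilinearFormsGraph (ZMod (p ^ s)) m n d) :
    Γᶜ.chromaticNumber = (Γ.indepNum : ℕ∞) ∧
    Γ.indepNum = Γᶜ.cliqueNum ∧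
    (∃ H : Γᶜ.Subgraph, IsCoreOf H) ∧
    (∀ H : Γᶜ.Subgraph, IsCoreOf H → IsMaximumCliqueSubgraph H) ∧
    ¬ IsCore Γᶜ := by
  have hk : m + 1 - d ≤ m := by omega
  have hadj : ∀ A B, Γᶜ.Adj A B ↔ A ≠ B ∧ d ≤ innerRank (A - B) := by
    intro A B
    rw [SimpleGraph.compl_adj, hΓ]
    simp only [bilinearFormsGraph]
    constructor
    · rintro ⟨h1, h2⟩
      exact ⟨h1, not_lt.mp fun h => h2 ⟨h1, h⟩⟩
    · rintro ⟨h1, h2⟩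
      exact ⟨h1, fun h => absurd h.2 (not_lt.mpr h2)⟩
  let α := Fin (m + 1 - d) → Fin n → ZMod (p ^ s)
  let c : Γᶜ.Coloring α := SimpleGraph.Coloring.mk
    (fun A i l => A (Fin.castLE hk i) l) (by
      intro A B hAB hc
      have hle : innerRank (A - B) ≤ d - 1 := by
        refine innerRank_le_of_rows_eq_zero (k := m + 1 - d) _ (by omega) fun i hi l => ?_
        exact sub_eq_zero.mpr (congrFun (congrFun hc ⟨i, hi⟩) l)
      have := ((hadj A B).mp hAB).2
      omega)
  obtain ⟨Ψ, hΨ⟩ := exists_innerRank_code p s (k := m + 1 - d) hmn (by omega)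
  let ι : (⊤ : SimpleGraph α) →g Γᶜ := ⟨Ψ, by
    intro x y hxy
    have h := hΨ (x - y) (sub_ne_zero.mpr hxy)
    have h0 : innerRank (0 : Matrix (Fin m) (Fin n) (ZMod (p ^ s))) ≤ 0 :=
      innerRank_le_of_rows_eq_zero (k := m) _ le_rfl fun _ _ _ => rfl
    rw [map_sub] at h
    refine (hadj _ _).mpr ⟨fun he => ?_, by omega⟩
    rw [he, sub_self] at h
    omega⟩
  have hc : ¬ Function.Injective c := by
    intro hinj
    have : Fact (1 < p ^ s) := ⟨Nat.one_lt_pow (by omega) (Fact.out : p.Prime).one_lt⟩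
    -- As `d ≥ 2`, the coloring ignores the last row, where `E` is supported.
    let E : Matrix (Fin m) (Fin n) (ZMod (p ^ s)) :=
      Matrix.single ⟨m - 1, by omega⟩ ⟨0, by omega⟩ 1
    have hE : c E = c 0 := by
      funext i l
      change E (Fin.castLE hk i) l = 0
      refine Matrix.single_apply_of_ne _ _ _ _ _ fun h => ?_
      have := congrArg Fin.val h.1
      simp at this
      omega
    have h1 := congrFun (congrFun (hinj hE) ⟨m - 1, by omega⟩) ⟨0, by omega⟩
    simp [E] at h1
  have hω := cliqueNum_eq_card_of_coloring_of_top_hom c ι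
  refine ⟨?_, SimpleGraph.cliqueNum_compl.symm, exists_isCoreOf_of_coloring_of_top_hom c ι,
    fun H hH => hH.isMaximumCliqueSubgraph c ι, not_isCore_of_coloring_of_top_hom c ι hc⟩
  rw [← SimpleGraph.cliqueNum_compl, hω]
  exact chromaticNumber_eq_card_of_coloring_of_top_hom c ι
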